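/- For a norm $N$ on $\mathbb R^2$ and sets $C,D\subseteq\mathbb R^2$ put $\mathrm{dist}_N(C,D)=\inf\{N(x-y):x\in C,\ y\in D\}\in[0,\infty]$ (with $\inf\emptyset=\infty$) and $\mathrm{dom}_N(A,B)=\{x\in\mathbb R^2:\mathrm{dist}_N(\{x\},A)\le\mathrm{dist}_N(\{x\},B)\}$. A zone diagram of two point sites $p,q$ with respect to $N$ is a pair $(R_1,R_2)$ of subsets of $\mathbb R^2$ with $R_1=\mathrm{dom}_N(\{p\},R_2)$ and $R_2=\mathrm{dom}_N(\{q\},R_1)$. The norm $N$ is called rotund if $N\left(\tfrac{v+w}{2}\right)<1$ whenever $N(v)=N(w)=1$ and $v\ne w$, and smooth if $N$ is differentiable at every point of $\mathbb R^2\setminus\{0\}$. Proposition. For every $\varepsilon>0$ there are $\alpha,\delta\in(0,1)$ such that $$N(x,y)=\delta\sqrt{\alpha^2x^2+y^2}+(1-\alpha\delta)|x|+(1-\delta)|y|$$ is a norm on $\mathbb R^2$ that is rotund and not smooth, that is $\varepsilon$-close to the $\ell_1$ norm in the sense that $$(1-\varepsilon)\,(|x|+|y|)\le N(x,y)\le |x|+|y|\qquad\text{for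 all }(x,y)\in\mathbb R^2,$$ and such that any two distinct points $p,q\in\mathbb R^2$ with the same $x$-coordinate have at least two different zone diagrams with respect to $N$. -/

import Mathlib

open scoped ENNReal

noncomputable section

namespace ZoneDiagram

variable {E : Type*} [AddCommGroup E] [Module ℝ E]

/-- A seminorm is a norm if it vanishes only at the origin. -/
def IsNorm (N : Seminorm ℝ E) : Prop :=
  ∀ v : E, N v = 0 → v = 0

/-- Rotundity (strict convexity) of a norm. -/
def IsRotund (N : Seminorm ℝ E) : Prop :=
  ∀ v w : E, N v = 1 → N w = 1 → v ≠ w → N ((1 / 2 : ℝ) • (v + w)) < 1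

/-- Smoothness of a norm on the plane: differentiability away from the origin (no norm is
differentiable at the origin). -/
def IsSmooth (N : Seminorm ℝ (ℝ × ℝ)) : Prop :=
  ∀ v : ℝ × ℝ, v ≠ 0 → DifferentiableAt ℝ (fun w => N w) v

/-- The distance between two sets with respect to the metric `N (x - y)`, with values in
`[0, ∞]`; it is `∞` if one of the sets is empty. -/
def setDist (N : Seminorm ℝ E) (C D : Set E) : ℝ≥0∞ :=
  ⨅ x ∈ C, ⨅ y ∈ D, ENNReal.ofReal (N (x - y))

/-- The dominance region of `A` over `B`. -/
def dom (N : Seminorm ℝ E) (A B : Set E) : Set E :=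
  {x | setDist N {x} A ≤ setDist N {x} B}

/-- `R` is a zone diagram of the tuple of sites `P`: every region `R i` is the dominance region
of the site `P i` over the union of the other regions. -/
def IsZoneDiagram {ι : Type*} (N : Seminorm ℝ E) (P R : ι → Set E) : Prop :=
  ∀ i, R i = dom N (P i) (⋃ j ∈ {j : ι | j ≠ i}, R j)

/-- The `ℓ₁` norm on the plane. -/
def l1 (v : ℝ × ℝ) : ℝ := |v.1| + |v.2|

/-- The inflated `ℓ₁` norm on the plane. -/
def inflatedL1 (α δ : ℝ) (v : ℝ × ℝ) : ℝ :=
  δ * Real.sqrt (α ^ 2 * v.1 ^ 2 + v.2 ^ 2) + (1 - α * δ) * |v.1| + (1 - δ) * |v.2|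

end ZoneDiagram

end

namespace ZoneDiagram

/-! Take `δ = 1 / 2` and `α` small. For sites `p`, `q`, the first regions of zone diagrams are the
fixed points of the monotone map `R ↦ dom N {p} (dom N {q} R)`, so the least and the greatest fixed
point each give a zone diagram, and it suffices to separate them.

Normalize the sites to `p = (0, -3)` and `q = (0, 3)`. The cone `y ≤ -1 - |x| / 3` is contained in
its image under this map (`cone_subset_dom_dom`), hence in the greatest fixed point. By symmetry the
opposite cone `A'` satisfies the analogous inclusion with the sites exchanged, so the least fixed
point is contained in `dom N {p} A'`. But far from the axis the two cones are closer to each other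
than to the sites, so the first cone does not lie in `dom N {p} A'`.

The substance is the inclusion for the cone, reduced to `inflated_le_of_dominated`: near `ℓ₁` it has
so little slack that the elliptic terms of order `α` must be tracked. -/

/-! ### The elliptic part of the inflated norm -/

/-- The Euclidean norm with the first coordinate scaled by `α`. -/
noncomputable def ellNorm (α x y : ℝ) : ℝ := Real.sqrt (α ^ 2 * x ^ 2 + y ^ 2)

lemma ellNorm_nonneg (α x y : ℝ) : 0 ≤ ellNorm α x y := Real.sqrt_nonneg _

lemma ellNorm_sq (α x y : ℝ) : ellNorm α x y ^ 2 = α ^ 2 * x ^ 2 + y ^ 2 :=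
  Real.sq_sqrt (by positivity)

lemma ellNorm_mono {α x y x' y' : ℝ} (hx : |x| ≤ |x'|) (hy : |y| ≤ |y'|) :
    ellNorm α x y ≤ ellNorm α x' y' := by
  have h1 := sq_le_sq.mpr hx
  have h2 := sq_le_sq.mpr hy
  exact Real.sqrt_le_sqrt (by gcongr)

lemma abs_le_ellNorm (α x y : ℝ) : |y| ≤ ellNorm α x y :=
  Real.abs_le_sqrt (by nlinarith [sq_nonneg (α * x)])

lemma mul_le_ellNorm (α x y : ℝ) : α * x ≤ ellNorm α x y :=
  (le_abs_self _).trans (Real.abs_le_sqrt (by nlinarith [sq_nonneg y]))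

/-- The Cauchy–Schwarz inequality. -/
lemma inner_le_ellNorm_mul (α x y x' y' : ℝ) :
    α ^ 2 * (x * x') + y * y' ≤ ellNorm α x y * ellNorm α x' y' := by
  refine le_of_abs_le (abs_le_of_sq_le_sq ?_
    (mul_nonneg (ellNorm_nonneg _ _ _) (ellNorm_nonneg _ _ _)))
  rw [mul_pow, ellNorm_sq, ellNorm_sq]
  nlinarith [sq_nonneg (α * (x * y' - y * x'))]

lemma ellNorm_add_le (α x y x' y' : ℝ) :
    ellNorm α (x + x') (y + y') ≤ ellNorm α x y + ellNorm α x' y' := by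
  refine le_of_sq_le_sq ?_ (add_nonneg (ellNorm_nonneg _ _ _) (ellNorm_nonneg _ _ _))
  have := inner_le_ellNorm_mul α x y x' y'
  rw [add_sq, ellNorm_sq, ellNorm_sq, ellNorm_sq]
  nlinarith

lemma ellNorm_add_lt {α x y x' y' : ℝ} (hα : α ≠ 0) (h : x * y' ≠ y * x') :
    ellNorm α (x + x') (y + y') < ellNorm α x y + ellNorm α x' y' := by
  refine lt_of_pow_lt_pow_left₀ 2 (add_nonneg (ellNorm_nonneg _ _ _) (ellNorm_nonneg _ _ _)) ?_
  have hpos : 0 < (α * (x * y' - y * x')) ^ 2 := by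
    have : x * y' - y * x' ≠ 0 := sub_ne_zero.mpr h
    positivity
  have : α ^ 2 * (x * x') + y * y' < ellNorm α x y * ellNorm α x' y' := by
    refine lt_of_abs_lt (abs_lt_of_sq_lt_sq ?_
      (mul_nonneg (ellNorm_nonneg _ _ _) (ellNorm_nonneg _ _ _)))
    rw [mul_pow, ellNorm_sq, ellNorm_sq]
    nlinarith
  rw [add_sq, ellNorm_sq, ellNorm_sq, ellNorm_sq]
  nlinarith

lemma ellNorm_mul (α c x y : ℝ) : ellNorm α (c * x) (c * y) = |c| * ellNorm α x y := by
  unfold ellNorm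
  rw [← Real.sqrt_sq_eq_abs, ← Real.sqrt_mul (sq_nonneg c)]
  congr 1
  ring

lemma ellNorm_zero_right {α x : ℝ} (hα : 0 ≤ α) : ellNorm α x 0 = α * |x| := by
  unfold ellNorm
  rw [show α ^ 2 * x ^ 2 + 0 ^ 2 = (α * x) ^ 2 by ring, Real.sqrt_sq_eq_abs, abs_mul,
    abs_of_nonneg hα]

lemma ellNorm_le_add {α : ℝ} (hα : 0 ≤ α) (x y : ℝ) : ellNorm α x y ≤ α * |x| + |y| := by
  refine (abs_le_of_sq_le_sq' ?_ (by positivity)).2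
  rw [ellNorm_sq]
  nlinarith [sq_abs x, sq_abs y, mul_nonneg hα (mul_nonneg (abs_nonneg x) (abs_nonneg y))]

lemma inflatedL1_eq (α δ : ℝ) (v : ℝ × ℝ) :
    inflatedL1 α δ v = δ * ellNorm α v.1 v.2 + (1 - α * δ) * |v.1| + (1 - δ) * |v.2| := rfl

/-! ### The inflated norm -/

section Norm

variable {α δ : ℝ}

/-- The inflated `ℓ₁` norm as a seminorm. -/
noncomputable def inflatedSeminorm (α δ : ℝ) (hα : 0 < α ∧ α < 1) (hδ : 0 < δ ∧ δ < 1) :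
    Seminorm ℝ (ℝ × ℝ) :=
  Seminorm.of (inflatedL1 α δ)
    (fun v w => by
      have h1 := ellNorm_add_le α v.1 v.2 w.1 w.2
      have h2 := abs_add_le v.1 w.1
      have h3 := abs_add_le v.2 w.2
      have h4 : 0 ≤ 1 - α * δ := by nlinarith
      have h5 : 0 ≤ 1 - δ := by linarith
      simp only [inflatedL1_eq, Prod.fst_add, Prod.snd_add]
      nlinarith [mul_le_mul_of_nonneg_left h1 hδ.1.le, mul_le_mul_of_nonneg_left h2 h4,
        mul_le_mul_of_nonneg_left h3 h5])
    (fun c v => by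
      simp only [inflatedL1_eq, Prod.smul_fst, Prod.smul_snd, smul_eq_mul, ellNorm_mul, abs_mul,
        Real.norm_eq_abs]
      ring)

lemma inflatedL1_le_l1 (hα : 0 ≤ α) (hδ : 0 ≤ δ) (v : ℝ × ℝ) : inflatedL1 α δ v ≤ l1 v := by
  have := mul_le_mul_of_nonneg_left (ellNorm_le_add hα v.1 v.2) hδ
  rw [inflatedL1_eq, l1]
  linarith

lemma le_inflatedL1 (hδ : 0 ≤ δ) (v : ℝ × ℝ) :
    (1 - α * δ) * |v.1| + |v.2| ≤ inflatedL1 α δ v := by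
  have := mul_le_mul_of_nonneg_left (abs_le_ellNorm α v.1 v.2) hδ
  rw [inflatedL1_eq]
  linarith

lemma isNorm_of_inflatedL1 {N : Seminorm ℝ (ℝ × ℝ)} (hN : ∀ v, N v = inflatedL1 α δ v)
    (hδ : 0 ≤ δ) (hαδ : α * δ < 1) : IsNorm N := by
  intro v hv
  have h := le_inflatedL1 (α := α) hδ v
  rw [← hN, hv] at h
  have h1 : 0 ≤ (1 - α * δ) * |v.1| := mul_nonneg (by linarith) (abs_nonneg _)
  have h2 := abs_nonneg v.2
  have h3 : |v.1| = 0 := by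
    rcases mul_eq_zero.mp (le_antisymm (by linarith) h1) with h | h
    · linarith
    · exact h
  exact Prod.ext (abs_eq_zero.mp h3) (abs_eq_zero.mp (by linarith))

/-- For non-parallel vectors the elliptic term makes the triangle inequality strict; distinct
parallel unit vectors are opposite, with midpoint `0`. -/
lemma isRotund_of_inflatedL1 {N : Seminorm ℝ (ℝ × ℝ)} (hN : ∀ v, N v = inflatedL1 α δ v)
    (hα : 0 < α) (hδ : 0 < δ) (hδ1 : δ ≤ 1) (hαδ : α * δ ≤ 1) : IsRotund N := by
  intro v w hv hw hvw
  rw [map_smul_eq_mul, Real.norm_eq_abs, abs_of_pos (by norm_num)]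
  by_cases h : v.1 * w.2 = v.2 * w.1
  · have hv0 : v ≠ 0 := by
      rintro rfl
      simp at hv
    obtain ⟨c, rfl⟩ : ∃ c : ℝ, w = c • v := by
      by_cases h1 : v.1 = 0
      · have h2 : v.2 ≠ 0 := fun h2 => hv0 (Prod.ext h1 h2)
        have h3 : w.1 = 0 := by simpa [h1, h2] using h.symm
        exact ⟨w.2 / v.2, Prod.ext (by simp [h1, h3]) (by simp [h2])⟩
      · refine ⟨w.1 / v.1, Prod.ext (by simp [h1]) ?_⟩
        simp only [Prod.smul_snd, smul_eq_mul]
        field_simp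
        linarith
    rw [map_smul_eq_mul, hv, mul_one, Real.norm_eq_abs] at hw
    rcases (abs_eq zero_le_one).mp hw with rfl | rfl
    · simp at hvw
    · simp
  · have h1 := ellNorm_add_lt hα.ne' h
    have h2 := mul_le_mul_of_nonneg_left (abs_add_le v.1 w.1) (sub_nonneg.mpr hαδ)
    have h3 := mul_le_mul_of_nonneg_left (abs_add_le v.2 w.2) (sub_nonneg.mpr hδ1)
    have h4 := mul_lt_mul_of_pos_left h1 hδ
    have h5 : N (v + w) < N v + N w := by
      simp only [hN, inflatedL1_eq, Prod.fst_add, Prod.snd_add]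
      linarith
    linarith

/-- Along `t ↦ (1, t)` the square root is differentiable at `0`, so the term `(1 - δ) * |t|` leaves
a kink at `(1, 0)`. -/
lemma not_isSmooth_of_inflatedL1 {N : Seminorm ℝ (ℝ × ℝ)} (hN : ∀ v, N v = inflatedL1 α δ v)
    (hα : α ≠ 0) (hδ1 : δ ≠ 1) : ¬ IsSmooth N := by
  intro h
  have h1 := h (1, 0) (by simp)
  have h2 : DifferentiableAt ℝ (fun t : ℝ => ((1, t) : ℝ × ℝ)) 0 := by fun_prop
  have h3 : DifferentiableAt ℝ (fun t : ℝ => N (1, t)) 0 :=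
    DifferentiableAt.comp (g := fun w => N w) (0 : ℝ) h1 h2
  have h4 : DifferentiableAt ℝ (fun t : ℝ => Real.sqrt (α ^ 2 + t ^ 2)) 0 :=
    DifferentiableAt.sqrt (by fun_prop) (by simp [hα])
  have h5 : (fun t : ℝ => |t|) = fun t =>
      (N (1, t) - δ * Real.sqrt (α ^ 2 + t ^ 2) - (1 - α * δ)) / (1 - δ) := by
    ext t
    have : 1 - δ ≠ 0 := sub_ne_zero.mpr hδ1.symm
    rw [hN, inflatedL1]
    field_simp
    simp
    ring
  apply not_differentiableAt_abs_zero
  have : DifferentiableAt ℝ (fun t : ℝ => |t|) 0 := by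
    rw [h5]
    fun_prop
  exact this

end Norm

/-! ### The key inequality -/

/-- Let `z = (X, -3 - Y)` lie below the graph of `-1 - |x| / 3`, and let `b = (x, 3 + h)` be no
farther from `(0, 3)` than from the point of this graph below `b`. Then `z` is no farther from
`(0, -3)` than from `b`. -/
lemma inflated_le_of_dominated {α X Y x h : ℝ} (hα : 0 < α) (hα' : α ≤ 1 / 100)
    (hX : 0 ≤ X) (hx : 0 ≤ x) (hY : X / 3 - 2 ≤ Y)
    (hb : ellNorm α x h / 2 + (1 - α / 2) * x + |h| / 2 ≤ h + 4 + x / 3) :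
    ellNorm α X Y / 2 + (1 - α / 2) * X + |Y| / 2 ≤
      ellNorm α (X - x) (Y + 6 + h) / 2 + (1 - α / 2) * |X - x| + |Y + 6 + h| / 2 := by
  have hxe := mul_le_ellNorm α x h
  -- linear consequences of `hb`
  have hlin : (0 ≤ h ∧ x ≤ 6 + 3 / 4 * h) ∨ (h < 0 ∧ x ≤ 6 + 9 / 4 * h) := by
    rcases le_or_gt 0 h with h0 | h0
    · rw [abs_of_nonneg h0] at hb
      exact Or.inl ⟨h0, by linarith⟩
    · rw [abs_of_neg h0] at hb
      exact Or.inr ⟨h0, by linarith⟩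
  have hxH : x ≤ 6 + h := by rcases hlin with ⟨_, _⟩ | ⟨_, _⟩ <;> linarith
  have hgap : (1 - α / 2) * x + 3 * α ≤ 6 + h := by
    rcases hlin with ⟨h0, h1⟩ | ⟨h0, h1⟩ <;> nlinarith
  rcases le_or_gt 0 Y with hY0 | hY0
  · rw [abs_of_nonneg hY0, abs_of_nonneg (by linarith : 0 ≤ Y + 6 + h)]
    rcases le_or_gt (X / 10) Y with hsteep | hflat
    · -- linearize the norm at `(X, Y)`
      rcases hX.eq_or_lt with rfl | hXpos
      · have h1 := abs_le_ellNorm α (0 - x) (Y + 6 + h)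
        have h2 : ellNorm α 0 Y = Y := by
          unfold ellNorm
          simp [Real.sqrt_sq hY0]
        rw [abs_of_nonneg (by linarith : 0 ≤ Y + 6 + h)] at h1
        have h3 : 0 ≤ (1 - α / 2) * |0 - x| := mul_nonneg (by linarith) (abs_nonneg _)
        rw [h2]
        linarith
      have hYpos : 0 < Y := by linarith
      set S := ellNorm α X Y with hS
      set W := ellNorm α (X - x) (Y + 6 + h) with hW
      have hSY : Y ≤ S := (le_abs_self _).trans (abs_le_ellNorm α X Y)
      have hSpos : 0 < S := by linarith
      have hSS : S ^ 2 = α ^ 2 * X ^ 2 + Y ^ 2 := ellNorm_sq α X Y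
      have hCS := inner_le_ellNorm_mul α X Y (X - x) (Y + 6 + h)
      rw [← hS, ← hW] at hCS
      -- Up to the factor `2 * S`, this says that the partial derivative of the norm in `x` at `(X,
      -- Y)` is at most the one in `y`. With `x ≤ 6 + h`, the supporting line at `(X, Y)` then gives
      -- the claim.
      have hder : S - Y ≤ α * (S - α * X) := by
        have h1 : (S - Y) * (2 * Y) ≤ α ^ 2 * X ^ 2 := by nlinarith
        have h2 : S - Y ≤ 5 * α ^ 2 * X := by
          by_contra! hlt
          have h3 : 5 * α ^ 2 * X * (2 * Y) < (S - Y) * (2 * Y) :=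
            mul_lt_mul_of_pos_right hlt (by linarith)
          have h4 : α ^ 2 * X * X ≤ α ^ 2 * X * (10 * Y) :=
            mul_le_mul_of_nonneg_left (by linarith) (by positivity)
          nlinarith
        have h3 : α * (X * (9 / 100)) ≤ α * (S - α * X) :=
          mul_le_mul_of_nonneg_left (by nlinarith) hα.le
        have h4 : α * X * (5 * α) ≤ α * X * (9 / 100) :=
          mul_le_mul_of_nonneg_left (by linarith) (by positivity)
        nlinarith
      have hmul : x * (S - α / 2 * (S - α * X)) ≤ (6 + h) * (S - (S - Y) / 2) :=
        mul_le_mul hxH (by linarith) (by nlinarith [mul_pos hα hXpos]) (by linarith)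
      have habs := mul_le_mul_of_nonneg_left (le_abs_self (X - x))
        (by linarith : 0 ≤ 1 - α / 2)
      have hfin : S * (S / 2 + (1 - α / 2) * x) ≤ S * (W / 2 + (6 + h) / 2) := by
        nlinarith
      have := le_of_mul_le_mul_left hfin hSpos
      linarith
    · have hW : Y + 6 + h ≤ ellNorm α (X - x) (Y + 6 + h) :=
        (le_abs_self _).trans (abs_le_ellNorm _ _ _)
      rcases le_or_gt x X with hxX | hxX
      -- The line `Y = X / 3 - 2` meets `Y = 0` at `X = 6`, where equality holds; half of `6 * α` is
      -- the slack `3 * α` in `hgap`.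
      · have hS : ellNorm α X Y ≤ 6 * α + Y := by
          refine (abs_le_of_sq_le_sq' ?_ (by positivity)).2
          rw [ellNorm_sq]
          have h1 : α * (X ^ 2 - 36) ≤ 12 * Y := by
            rcases le_or_gt X 6 with h6 | h6
            · have h2 : α * (X ^ 2 - 36) ≤ 0 :=
                mul_nonpos_of_nonneg_of_nonpos hα.le (by nlinarith)
              linarith
            · have h9 : X ≤ 9 := by linarith
              have h2 : α * (X + 6) ≤ 4 := by nlinarith
              nlinarith [mul_le_mul_of_nonneg_right h2 (by linarith : 0 ≤ X - 6)]
          nlinarith [mul_le_mul_of_nonneg_left h1 hα.le]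
        rw [abs_of_nonneg (by linarith : 0 ≤ X - x)]
        linarith
      · have hS := ellNorm_le_add hα.le X Y
        rw [abs_of_nonneg hX, abs_of_nonneg hY0] at hS
        have h1 : 0 ≤ (1 - α / 2) * |X - x| := mul_nonneg (by linarith) (abs_nonneg _)
        linarith
  · have hh : -3 ≤ h := by rcases hlin with ⟨_, _⟩ | ⟨_, _⟩ <;> linarith
    have hH : 0 ≤ Y + 6 + h := by linarith
    have hW := abs_le_ellNorm α (X - x) (Y + 6 + h)
    rw [abs_of_nonneg hH] at hW
    rw [abs_of_neg hY0, abs_of_nonneg hH]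
    have hd := abs_nonneg (X - x)
    rcases hlin with ⟨h0, h1⟩ | ⟨h0, h1⟩
    · have hS := ellNorm_le_add hα.le X Y
      rw [abs_of_nonneg hX, abs_of_neg hY0] at hS
      have h2 : 0 ≤ (1 - α / 2) * |X - x| := mul_nonneg (by linarith) hd
      linarith
    -- Here `w` is the height of the graph above the site at abscissa `X`, so `-Y ≤ w` and `X = 6 -
    -- 3 * w`. The bound `hb` is moved from `x` to `X` at a cost proportional to `d`, which the term
    -- `(1 - α / 2) * d` absorbs.
    · set d := |X - x| with hd'
      set w := 2 - X / 3 with hw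
      have hXx : X - x ≤ d := le_abs_self _
      have hxX : x - X ≤ d := by rw [hd', abs_sub_comm]; exact le_abs_self _
      rw [abs_of_neg h0] at hb
      -- `e` is monotone and Lipschitz in each variable
      have e1 : ellNorm α X Y ≤ ellNorm α X w :=
        ellNorm_mono le_rfl (by rw [abs_of_neg hY0, abs_of_nonneg] <;> linarith)
      have e2 : α * x - ellNorm α x h ≤ α * X - ellNorm α X h + α * d := by
        rcases le_or_gt x X with hle | hlt
        · have := ellNorm_add_le α x h (X - x) 0
          rw [ellNorm_zero_right hα.le, ← hd'] at this
          simp only [add_sub_cancel, add_zero] at this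
          nlinarith
        · have := ellNorm_mono (α := α) (x := X) (x' := x) (y := h) (y' := h)
            (by rw [abs_of_nonneg hX, abs_of_nonneg hx]; exact hlt.le) le_rfl
          nlinarith
      have e3 : -h ≤ 4 / 3 * w + 4 / 9 * d := by
        have := abs_le_ellNorm α x h
        rw [abs_of_neg h0] at this
        nlinarith
      have hw0 : 0 ≤ w := by linarith
      -- The function `t - ellNorm α X t` is nondecreasing. The value `2 * w` is chosen because `(X,
      -- 0) + (X, 2 * w) = 2 • (X, w)`, which yields `e5`.
      have e4 : -h - ellNorm α X h ≤ 2 * w + 4 / 9 * d - ellNorm α X (2 * w) := by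
        rcases le_or_gt (-h) (2 * w) with hle | hlt
        · have := ellNorm_add_le α X (-h) 0 (2 * w + h)
          have h2 : ellNorm α 0 (2 * w + h) = 2 * w + h := by
            unfold ellNorm
            simp [Real.sqrt_sq (by linarith : 0 ≤ 2 * w + h)]
          have h3 : ellNorm α X (-h) = ellNorm α X h := by
            unfold ellNorm
            simp
          rw [h2, h3, add_zero, show -h + (2 * w + h) = 2 * w by ring] at this
          linarith
        · have := ellNorm_mono (α := α) (x := X) (x' := X) (y := 2 * w) (y' := h) le_rfl
            (by rw [abs_of_neg h0, abs_of_nonneg] <;> linarith)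
          linarith
      have e5 : 2 * ellNorm α X w ≤ α * X + ellNorm α X (2 * w) := by
        have h2 := ellNorm_add_le α X 0 X (2 * w)
        rw [ellNorm_zero_right hα.le, abs_of_nonneg hX, zero_add,
          show X + X = 2 * X by ring, ellNorm_mul, abs_two] at h2
        exact h2
      nlinarith [mul_nonneg hα.le hd]

/-! ### Dominance regions and zone diagrams of two points -/

section Order

variable {E : Type*} [AddCommGroup E] [Module ℝ E] {N : Seminorm ℝ E}

lemma mem_dom_singleton {p x : E} {B : Set E} :
    x ∈ dom N {p} B ↔ ∀ b ∈ B, N (x - p) ≤ N (x - b) := by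
  simp [dom, setDist, ENNReal.ofReal_le_ofReal_iff (apply_nonneg N _)]

lemma dom_antitone (p : E) : Antitone (dom N {p}) := fun _ _ h _ hx =>
  mem_dom_singleton.mpr fun b hb => mem_dom_singleton.mp hx b (h hb)

lemma isZoneDiagram_pair {p q : E} {R : Set E} (hR : dom N {p} (dom N {q} R) = R) :
    IsZoneDiagram N ![{p}, {q}] ![R, dom N {q} R] := by
  have h0 : ∀ S : Fin 2 → Set E, (⋃ j ∈ {j : Fin 2 | j ≠ 0}, S j) = S 1 := by
    intro S
    ext x
    simp [Fin.exists_fin_two]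
  have h1 : ∀ S : Fin 2 → Set E, (⋃ j ∈ {j : Fin 2 | j ≠ 1}, S j) = S 0 := by
    intro S
    ext x
    simp [Fin.exists_fin_two]
  intro i
  fin_cases i
  · exact hR.symm.trans (congrArg (dom N {p}) (h0 ![R, dom N {q} R]).symm)
  · exact congrArg (dom N {q}) (h1 ![R, dom N {q} R]).symm

/-- If `A` and `A'` are post-fixed points of the dominance maps of `(p, q)` and of `(q, p)`, and
if `A` is not contained in the region of `p` over `A'`, then the least and the greatest
zone diagram differ. -/
lemma exists_ne_isZoneDiagram {p q : E} {A A' : Set E}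
    (hA : A ⊆ dom N {p} (dom N {q} A)) (hA' : A' ⊆ dom N {q} (dom N {p} A'))
    (hne : ¬ A ⊆ dom N {p} A') :
    ∃ R S : Fin 2 → Set E, R ≠ S ∧
      IsZoneDiagram N ![{p}, {q}] R ∧ IsZoneDiagram N ![{p}, {q}] S := by
  let T : Set E →o Set E := ⟨fun R => dom N {p} (dom N {q} R),
    (dom_antitone p).comp (dom_antitone q)⟩
  refine ⟨_, _, ?_, isZoneDiagram_pair (R := T.gfp) T.map_gfp,
    isZoneDiagram_pair (R := T.lfp) T.map_lfp⟩
  intro h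
  have heq : T.gfp = T.lfp := congrFun h 0
  have h1 : A ≤ T.gfp := T.le_gfp hA
  -- Applying the antitone `dom N {p}` to `hA'` makes `dom N {p} A'` a pre-fixed point of `T`.
  have h2 : T.lfp ≤ dom N {p} A' := T.lfp_le (dom_antitone p hA')
  exact hne (h1.trans (heq.le.trans h2))

end Order

/-! ### The cone below the first site -/

/-- The image of the cone `{(x, y) | y ≤ -1 - |x| / 3}` under `z ↦ m + s • z`. -/
def cone (m : ℝ × ℝ) (s : ℝ) : Set (ℝ × ℝ) :=
  {w | ∃ z : ℝ × ℝ, z.2 ≤ -1 - |z.1| / 3 ∧ w = m + s • z}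

section Cone

variable {α : ℝ} {N : Seminorm ℝ (ℝ × ℝ)}

lemma inflatedL1_sub_abs_le (hα : 0 < α) (hα' : α ≤ 1 / 100) (x x' y : ℝ) :
    inflatedL1 α (1 / 2) (|x| - |x'|, y) ≤ inflatedL1 α (1 / 2) (x - x', y) := by
  have h := abs_abs_sub_abs_le x x'
  have h1 := ellNorm_mono (α := α) h (le_refl |y|)
  have h2 := mul_le_mul_of_nonneg_left h (by linarith : 0 ≤ 1 - α * (1 / 2))
  simp only [inflatedL1_eq]
  linarith

lemma inflatedL1_sub_le_of_mem_cone (hα : 0 < α) (hα' : α ≤ 1 / 100) {z b : ℝ × ℝ}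
    (hz : z.2 ≤ -1 - |z.1| / 3)
    (hb : ∀ a : ℝ × ℝ, a.2 ≤ -1 - |a.1| / 3 →
      inflatedL1 α (1 / 2) (b - (0, 3)) ≤ inflatedL1 α (1 / 2) (b - a)) :
    inflatedL1 α (1 / 2) (z - (0, -3)) ≤ inflatedL1 α (1 / 2) (z - b) := by
  obtain ⟨X, Y⟩ := z
  obtain ⟨x, y⟩ := b
  simp only at hz
  -- Otherwise `b` lies in the cone, at distance `0` from it, and would have to be at the height of
  -- the site `(0, 3)`.
  have hy : -1 - |x| / 3 ≤ y := by
    by_contra! hlt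
    have h1 := hb (x, y) hlt.le
    have h2 := le_inflatedL1 (α := α) (δ := 1 / 2) (by norm_num) ((x, y) - (0, 3))
    have h3 : inflatedL1 α (1 / 2) ((x, y) - (x, y)) = 0 := by simp [inflatedL1]
    simp only [Prod.mk_sub_mk, sub_zero] at h2
    have h4 : 0 ≤ (1 - α * (1 / 2)) * |x| := mul_nonneg (by linarith) (abs_nonneg _)
    have h5 : |y - 3| ≤ 0 := by
      simp only [Prod.mk_sub_mk, sub_zero] at h1 h3
      linarith
    have h6 := (abs_le.mp h5).1
    linarith [abs_nonneg x]
  have hdom := hb (x, -1 - |x| / 3) le_rfl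
  have hvert : inflatedL1 α (1 / 2) ((x, y) - (x, -1 - |x| / 3)) = y + 1 + |x| / 3 := by
    have h0 : 0 ≤ y - (-1 - |x| / 3) := by linarith
    simp [inflatedL1, -sub_neg_eq_add, Real.sqrt_sq h0, abs_of_nonneg h0]
    ring
  rw [hvert] at hdom
  simp only [inflatedL1_eq, Prod.mk_sub_mk, sub_zero] at hdom
  have hell : ellNorm α x (y - 3) = ellNorm α |x| (y - 3) := by simp [ellNorm]
  have key := inflated_le_of_dominated (Y := -3 - Y) (h := y - 3) hα hα' (abs_nonneg X)
    (abs_nonneg x) (by linarith) (by rw [hell] at hdom; linarith)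
  have hred := inflatedL1_sub_abs_le hα hα' X x (Y - y)
  refine le_trans ?_ hred
  have h1 : ellNorm α |X| (-3 - Y) = ellNorm α X (Y - -3) := by
    unfold ellNorm
    rw [sq_abs]
    congr 1
    ring
  have h2 : ellNorm α (|X| - |x|) (-3 - Y + 6 + (y - 3)) = ellNorm α (|X| - |x|) (Y - y) := by
    unfold ellNorm
    congr 1
    ring
  have h3 : |-3 - Y| = |Y - -3| := abs_sub_comm _ _
  have h4 : |-3 - Y + 6 + (y - 3)| = |Y - y| := by
    rw [abs_sub_comm Y y]
    congr 1
    ring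
  rw [h1, h2, h3, h4] at key
  simp only [inflatedL1_eq, Prod.mk_sub_mk, sub_zero]
  linarith

lemma cone_subset_dom_dom (hN : ∀ v, N v = inflatedL1 α (1 / 2) v) (hα : 0 < α)
    (hα' : α ≤ 1 / 100) (m : ℝ × ℝ) {s : ℝ} (hs : s ≠ 0) :
    cone m s ⊆ dom N {m + s • (0, -3)} (dom N {m + s • (0, 3)} (cone m s)) := by
  have hscale : ∀ u v : ℝ × ℝ, N (m + s • u - (m + s • v)) = |s| * N (u - v) := by
    intro u v
    rw [add_sub_add_left_eq_sub, ← smul_sub, map_smul_eq_mul, Real.norm_eq_abs]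
  rintro _ ⟨z, hz, rfl⟩
  refine mem_dom_singleton.mpr fun b hb => ?_
  obtain ⟨b, rfl⟩ : ∃ b', b = m + s • b' := ⟨s⁻¹ • (b - m), by simp [smul_inv_smul₀ hs]⟩
  rw [mem_dom_singleton] at hb
  rw [hscale, hscale]
  refine mul_le_mul_of_nonneg_left ?_ (abs_nonneg s)
  rw [hN, hN]
  refine inflatedL1_sub_le_of_mem_cone hα hα' hz fun a ha => ?_
  have := hb _ ⟨a, ha, rfl⟩
  rw [hscale, hscale] at this
  rw [← hN, ← hN]
  exact le_of_mul_le_mul_left this (abs_pos.mpr hs)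

lemma not_cone_subset_dom (hN : ∀ v, N v = inflatedL1 α (1 / 2) v) (m : ℝ × ℝ) {s : ℝ}
    (hα' : α ≤ 1 / 100) (hs : s ≠ 0) :
    ¬ cone m s ⊆ dom N {m + s • (0, -3)} (cone m (-s)) := by
  intro hsub
  -- `(12, -5)` is on the boundary of the cone, at distance `10` from its mirror image but at least
  -- `14 - 6 * α` from `(0, -3)`.
  have hmem : m + s • ((12, -5) : ℝ × ℝ) ∈ cone m s := ⟨(12, -5), by norm_num [abs_of_pos], rfl⟩
  have hmem' : m + s • ((12, 5) : ℝ × ℝ) ∈ cone m (-s) :=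
    ⟨(-12, -5), by norm_num [abs_of_pos], by simp⟩
  have h := mem_dom_singleton.mp (hsub hmem) _ hmem'
  rw [add_sub_add_left_eq_sub, ← smul_sub, map_smul_eq_mul, add_sub_add_left_eq_sub, ← smul_sub,
    map_smul_eq_mul] at h
  have h1 := le_of_mul_le_mul_left h (norm_pos_iff.mpr hs)
  rw [hN, hN] at h1
  have h2 := (le_inflatedL1 (α := α) (by norm_num) _).trans h1
  have h3 : inflatedL1 α (1 / 2) ((12, -5) - (12, 5)) = 10 := by
    norm_num [inflatedL1]
  rw [h3] at h2
  norm_num at h2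
  linarith

end Cone

end ZoneDiagram

theorem mainTheorem4 (ε : ℝ) (hε : 0 < ε) :
    ∃ α δ : ℝ, 0 < α ∧ α < 1 ∧ 0 < δ ∧ δ < 1 ∧
      ∃ N : Seminorm ℝ (ℝ × ℝ),
        (∀ v, N v = ZoneDiagram.inflatedL1 α δ v) ∧
        ZoneDiagram.IsNorm N ∧
        ZoneDiagram.IsRotund N ∧
        ¬ ZoneDiagram.IsSmooth N ∧
        (∀ v, (1 - ε) * ZoneDiagram.l1 v ≤ N v ∧ N v ≤ ZoneDiagram.l1 v) ∧
        ∀ p q : ℝ × ℝ, p.1 = q.1 → p ≠ q →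
          ∃ R S : Fin 2 → Set (ℝ × ℝ), R ≠ S ∧
            ZoneDiagram.IsZoneDiagram N ![{p}, {q}] R ∧
            ZoneDiagram.IsZoneDiagram N ![{p}, {q}] S := by
  open ZoneDiagram in
  obtain ⟨α, hα, hα', hαε⟩ : ∃ α : ℝ, 0 < α ∧ α ≤ 1 / 100 ∧ α ≤ ε :=
    ⟨min (1 / 100) ε, lt_min (by norm_num) hε, min_le_left _ _, min_le_right _ _⟩
  let N := inflatedSeminorm α (1 / 2) ⟨hα, by linarith⟩ ⟨by norm_num, by norm_num⟩
  have hN : ∀ v, N v = inflatedL1 α (1 / 2) v := fun _ => rfl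
  refine ⟨α, 1 / 2, hα, by linarith, by norm_num, by norm_num, N, hN,
    isNorm_of_inflatedL1 hN (by norm_num) (by linarith),
    isRotund_of_inflatedL1 hN hα (by norm_num) (by norm_num) (by linarith),
    not_isSmooth_of_inflatedL1 hN hα.ne' (by norm_num), fun v => ⟨?_, ?_⟩, ?_⟩
  · refine le_trans ?_ ((le_inflatedL1 (by norm_num) v).trans (hN v).ge)
    rw [l1]
    nlinarith [abs_nonneg v.1, abs_nonneg v.2, mul_nonneg hε.le (abs_nonneg v.2),
      mul_le_mul_of_nonneg_right hαε (abs_nonneg v.1), mul_nonneg hα.le (abs_nonneg v.1)]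
  · exact (hN v).le.trans (inflatedL1_le_l1 hα.le (by norm_num) v)
  · rintro ⟨c, a⟩ ⟨c', b⟩ hc hne
    obtain rfl : c = c' := hc
    have hab : b - a ≠ 0 := fun h => hne (by rw [sub_eq_zero.mp h])
    let m : ℝ × ℝ := (c, (a + b) / 2)
    let s : ℝ := (b - a) / 6
    have hs : s ≠ 0 := div_ne_zero hab (by norm_num)
    have hp : ((c, a) : ℝ × ℝ) = m + s • (0, -3) := by
      ext <;> simp [m, s]; ring
    have hq : ((c, b) : ℝ × ℝ) = m + s • (0, 3) := by
      ext <;> simp [m, s]; ring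
    rw [hp, hq]
    refine exists_ne_isZoneDiagram (cone_subset_dom_dom hN hα hα' m hs) ?_
      (not_cone_subset_dom hN m hα' hs)
    -- Negating `s` exchanges the two sites and the two cones.
    simpa using cone_subset_dom_dom hN hα hα' m (neg_ne_zero.mpr hs)
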